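/- In the adjacency list model, a directed graph on $n$ vertices with out-degree $k$ is given by a function $f:[n]\times[k]\to[n]$, where $[m]=\{0,\dots,m-1\}$ and $f(u,i)$ is the $i$-th out-neighbour of $u$, under the promise that $f(u,i)\ne f(u,j)$ for all $u$ and all $i\neq j$. A quantum algorithm accesses $f$ only through the unitary $|u,i,b,z\rangle\mapsto|u,i,b+f(u,i) \bmod n,z\rangle$ (one query), where $z$ is a finite workspace register. Between the queries it applies arbitrary unitaries that do not depend on $f$, and it ends with a measurement in the computational basis. Let $Q(n,k)$ be the least number of queries of such an algorithm that decides, with error probability at most $1/3$ on every $f$ satisfying the promise, whether the graph given by $f$ is strongly connected (that is, whether for all vertices $s,t$ there is a directed path from $s$ to $t$). **Theorem.** Strong connectivity of directed graphs with out-degree $k$ needs $\Omega(n\sqrt k)$ quantum queries in the list model, as long as $k$ stays a constant fraction of $n$ away from $n$. Precisely: for every $\varepsilon>0$ there is a constant $c>0$, depending only on $\varepsilon$, such that $$Q(n,k)\;\ge\; c\,n\sqrt k\qquad\text{for all integers } n,k \text{ with } 1\le k\le(1-\varepsilon)n .$$ -/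

import Mathlib

open scoped ENNReal

namespace ListModel

/-- The adjacency-list encoding of a directed graph on the vertices `0, …, n - 1` in which every
vertex has `k` numbered outgoing edges: `f u i` is the `i`-th neighbour of `u`. -/
abbrev ListInput (n k : ℕ) : Type := Fin n → Fin k → Fin n

/-- The simple graph promise: different outgoing edges of a vertex have different ends. -/
def IsSimple {n k : ℕ} (f : ListInput n k) : Prop :=
  ∀ (u : Fin n) (i j : Fin k), i ≠ j → f u i ≠ f u j

/-- The directed graph encoded by `f`. -/
def graph {n k : ℕ} (f : ListInput n k) : Digraph (Fin n) where
  Adj u v := ∃ i : Fin k, f u i = v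

/-- A directed graph is strongly connected if every ordered pair of vertices is joined by a
directed path. -/
def StronglyConnected {V : Type*} (G : Digraph V) : Prop :=
  ∀ s t : V, Relation.ReflTransGen G.Adj s t

/-- Computational basis states `|u, i, b, z⟩`: the query registers `u`, `i`, the answer
register `b`, and a workspace register `z` with `w` basis states. -/
abbrev BasisState (n k w : ℕ) : Type := Fin n × Fin k × Fin n × Fin w

/-- Pure (not necessarily normalised) states of the quantum registers. -/
abbrev QState (n k w : ℕ) : Type := EuclideanSpace ℂ (BasisState n k w)

/-- The permutation `(u, i, b, z) ↦ (u, i, b + f u i, z)` of the basis states, with addition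
modulo `n`. -/
def queryPerm {n k : ℕ} (w : ℕ) (f : ListInput n k) : Equiv.Perm (BasisState n k w) where
  toFun x := (x.1, x.2.1, x.2.2.1 + f x.1 x.2.1, x.2.2.2)
  invFun x := (x.1, x.2.1, x.2.2.1 - f x.1 x.2.1, x.2.2.2)
  left_inv := by
    rintro ⟨u, i, b, z⟩
    have : NeZero n := ⟨by have := u.isLt; omega⟩
    simp
  right_inv := by
    rintro ⟨u, i, b, z⟩
    have : NeZero n := ⟨by have := u.isLt; omega⟩
    simp

/-- One quantum query to `f`: the unitary with `|u, i, b, z⟩ ↦ |u, i, b + f u i, z⟩`. -/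
noncomputable def oracle {n k : ℕ} (w : ℕ) (f : ListInput n k) :
    QState n k w ≃ₗᵢ[ℂ] QState n k w :=
  LinearIsometryEquiv.piLpCongrLeft 2 ℂ ℂ (queryPerm w f)

/-- The oracle acts on computational basis states as stated. -/
theorem oracle_single {n k w : ℕ} (f : ListInput n k) (u : Fin n) (i : Fin k) (b : Fin n)
    (z : Fin w) :
    oracle w f (EuclideanSpace.single (u, i, b, z) 1) =
      EuclideanSpace.single (u, i, b + f u i, z) 1 := by
  simp [oracle, queryPerm]

/-- A quantum query algorithm making `T` queries: a workspace size, a unit start vector,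
unitaries `U 0, …, U T` independent of the input, and a set of accepting outcomes of the final
measurement in the computational basis. -/
structure QueryAlgorithm (n k T : ℕ) where
  /-- dimension of the workspace register -/
  w : ℕ
  /-- start vector -/
  init : QState n k w
  norm_init : ‖init‖ = 1
  /-- the input-independent unitaries; `U t` is applied after the `t`-th query -/
  U : Fin (T + 1) → (QState n k w ≃ₗᵢ[ℂ] QState n k w)
  /-- the outcomes on which the algorithm accepts -/
  accept : Finset (BasisState n k w)

namespace QueryAlgorithm

variable {n k T : ℕ}

/-- The state `U t · O_f · U (t-1) ⋯ O_f · U 0 · init` after `t` queries. -/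
noncomputable def stateAfter (A : QueryAlgorithm n k T) (f : ListInput n k) :
    (t : ℕ) → t ≤ T → QState n k A.w
  | 0, _ => A.U 0 A.init
  | t + 1, h => A.U ⟨t + 1, by omega⟩ (oracle A.w f (A.stateAfter f t (by omega)))

/-- The probability that `A` accepts the input `f`. -/
noncomputable def acceptProb (A : QueryAlgorithm n k T) (f : ListInput n k) : ℝ :=
  ∑ x ∈ A.accept, ‖A.stateAfter f T le_rfl x‖ ^ 2

/-- `A` decides strong connectivity with error probability at most `1/3` on every input that
satisfies the simple graph promise. -/
def DecidesStrongConnectivity (A : QueryAlgorithm n k T) : Prop :=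
  ∀ f : ListInput n k, IsSimple f →
    (StronglyConnected (graph f) → 2 / 3 ≤ A.acceptProb f) ∧
    (¬ StronglyConnected (graph f) → A.acceptProb f ≤ 1 / 3)

end QueryAlgorithm

/-- The bounded-error quantum query complexity of strong connectivity in the list model for
directed graphs with `n` vertices and out-degree `k`: the least number of queries of an
algorithm that decides it (`⊤` if there were none). -/
noncomputable def strongConnectivityComplexity (n k : ℕ) : ℕ∞ :=
  ⨅ (T : ℕ) (_ : ∃ A : QueryAlgorithm n k T, A.DecidesStrongConnectivity), (T : ℕ∞)

end ListModel

/-! ### The adversary method: inner products of states under queries. -/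

namespace ListModel

open Finset

variable {n k w : ℕ}

/-! The bound is an adversary argument: tell one cycle from two when every edge of the cycle is
hidden among `k` slots. For `k ≥ 2` the core consists of `m = n - k` vertices carrying a
permutation. Vertex `v` follows it by its edge number `p v`; its other edges go to the `k` hubs,
which lead to one another and back to `0`. The graph is strongly connected for one cycle on the
core, and not for two. For `k = 1` there are no hubs and `m = n`.

Both permutations are conjugated by a uniformly random `e`, and `p` is uniform too. They differ at
the two points of `Z`, where the placement is also shifted by a random `s`. So the two inputs of a
pair differ at most in the slots `p (e z)` and `p (e z) + s` of the rows `e z`.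

Composing `e` with a power of the permutation keeps the conjugate but moves `e z` along its cycle.
Hence a query hits the row `e z` with average weight at most `1 / L`, where `L` bounds the cycle
lengths from below (`mul_sum_conj_le`). Of the two slots, an input marks only its own special one;
averaging over `s` gains a factor `1 / k` at the other. Weighting these by `1 / √k` and `√k`
balances them: the average progress per query is `O(|Z| / (L √k))` (`sqrt_mul_le_of_perm_pair`).
Since the total progress must be a constant and `L` is of order `m ≥ ε n`, the theorem follows. -/

/-- The weight that a state puts on querying the entry `q` of the input. -/
noncomputable def queryMass (ψ : QState n k w) (q : Fin n × Fin k) : ℝ :=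
  ∑ x : Fin n × Fin w, ‖ψ (q.1, q.2, x)‖ ^ 2

theorem queryMass_nonneg (ψ : QState n k w) (q : Fin n × Fin k) : 0 ≤ queryMass ψ q :=
  sum_nonneg fun _ _ => by positivity

theorem sum_basisState {M : Type*} [AddCommMonoid M] (F : BasisState n k w → M) :
    ∑ x, F x = ∑ q : Fin n × Fin k, ∑ x : Fin n × Fin w, F (q.1, q.2, x) := by
  rw [← Fintype.sum_prod_type']
  exact (Fintype.sum_equiv (Equiv.prodAssoc (Fin n) (Fin k) (Fin n × Fin w)) _ _
    fun _ => rfl).symm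

theorem sum_queryMass (ψ : QState n k w) : ∑ q, queryMass ψ q = ‖ψ‖ ^ 2 := by
  rw [EuclideanSpace.norm_sq_eq, sum_basisState]
  rfl

theorem re_inner_eq_sum (ψ φ : QState n k w) :
    (inner ℂ ψ φ).re = ∑ x, (inner ℂ (ψ x) (φ x)).re := by
  rw [PiLp.inner_apply, Complex.re_sum]

theorem oracle_apply (f : ListInput n k) (ψ : QState n k w) (u : Fin n) (i : Fin k)
    (x : Fin n × Fin w) :
    oracle w f ψ (u, i, x) = ψ (u, i, x.1 - f u i, x.2) := rfl

/-- Cauchy–Schwarz, then weighted AM–GM with the weights `A` and `A⁻¹ ≤ B`. -/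
theorem abs_re_inner_le_of_one_le_mul {A B : ℝ} (hA : 0 ≤ A) (hAB : 1 ≤ A * B) (x y : ℂ) :
    |(inner ℂ x y).re| ≤ (A * ‖x‖ ^ 2 + B * ‖y‖ ^ 2) / 2 := by
  have h1 : |(inner ℂ x y).re| ≤ ‖x‖ * ‖y‖ :=
    (Complex.abs_re_le_norm _).trans (norm_inner_le_norm x y)
  have hA' : 0 < A := by
    rcases hA.eq_or_lt with h | h
    · rw [← h] at hAB; norm_num at hAB
    · exact h
  have hB : A⁻¹ ≤ B := by rw [inv_le_iff_one_le_mul₀' hA']; exact hAB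
  have h2 : A * ‖x‖ ^ 2 + A⁻¹ * ‖y‖ ^ 2 - 2 * (‖x‖ * ‖y‖) = A * (‖x‖ - A⁻¹ * ‖y‖) ^ 2 := by
    field_simp
    ring
  have h3 : 0 ≤ A * (‖x‖ - A⁻¹ * ‖y‖) ^ 2 := by positivity
  have h4 : A⁻¹ * ‖y‖ ^ 2 ≤ B * ‖y‖ ^ 2 := by gcongr
  linarith

theorem sum_sub_left {M : Type*} [AddCommMonoid M] (c : Fin n) (F : Fin n × Fin w → M) :
    ∑ x : Fin n × Fin w, F (x.1 - c, x.2) = ∑ x, F x := by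
  have : NeZero n := ⟨by have := c.isLt; omega⟩
  exact Fintype.sum_equiv ((Equiv.subRight c).prodCongr (Equiv.refl _)) _ _ fun _ => rfl

/-- A query changes the inner product of two states only through the entries in which the two
inputs differ. -/
theorem re_inner_sub_re_inner_oracle_le (f g : ListInput n k) (ψ φ : QState n k w)
    (A B : Fin n × Fin k → ℝ) (hA : ∀ q, 0 ≤ A q) (hB : ∀ q, 0 ≤ B q)
    (hAB : ∀ q : Fin n × Fin k, f q.1 q.2 ≠ g q.1 q.2 → 1 ≤ A q * B q) :
    (inner ℂ ψ φ).re - (inner ℂ (oracle w f ψ) (oracle w g φ)).re ≤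
      ∑ q, (A q * queryMass ψ q + B q * queryMass φ q) := by
  rw [re_inner_eq_sum, re_inner_eq_sum, sum_basisState, sum_basisState, ← sum_sub_distrib]
  refine sum_le_sum fun q _ => ?_
  simp only [oracle_apply]
  -- Where the inputs agree, both answer registers are shifted alike and the inner product is
  -- unchanged. Elsewhere the terms before and after the query are each bounded by half of the right
  -- side.
  by_cases h : f q.1 q.2 = g q.1 q.2
  · rw [h, sum_sub_left (g q.1 q.2) fun x => (inner ℂ (ψ (q.1, q.2, x)) (φ (q.1, q.2, x))).re,
      sub_self]
    exact add_nonneg (mul_nonneg (hA q) (queryMass_nonneg ψ q))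
      (mul_nonneg (hB q) (queryMass_nonneg φ q))
  · have key := abs_re_inner_le_of_one_le_mul (hA q) (hAB q h)
    have h1 : ∑ x : Fin n × Fin w, (inner ℂ (ψ (q.1, q.2, x)) (φ (q.1, q.2, x))).re ≤
        (A q * queryMass ψ q + B q * queryMass φ q) / 2 := by
      refine (sum_le_sum fun x _ => (le_abs_self _).trans (key _ _)).trans_eq ?_
      rw [← sum_div, sum_add_distrib, ← mul_sum, ← mul_sum]
      rfl
    have h2 : -∑ x : Fin n × Fin w, (inner ℂ (ψ (q.1, q.2, x.1 - f q.1 q.2, x.2))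
        (φ (q.1, q.2, x.1 - g q.1 q.2, x.2))).re ≤
        (A q * queryMass ψ q + B q * queryMass φ q) / 2 := by
      rw [← sum_neg_distrib]
      refine (sum_le_sum fun x _ => (neg_le_abs _).trans (key _ _)).trans_eq ?_
      rw [← sum_div, sum_add_distrib, ← mul_sum, ← mul_sum,
        sum_sub_left (f q.1 q.2) fun x => ‖ψ (q.1, q.2, x)‖ ^ 2,
        sum_sub_left (g q.1 q.2) fun x => ‖φ (q.1, q.2, x)‖ ^ 2]
      rfl
    linarith

namespace QueryAlgorithm

variable {T : ℕ} (A : QueryAlgorithm n k T)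

theorem norm_stateAfter (f : ListInput n k) (t : ℕ) (h : t ≤ T) :
    ‖A.stateAfter f t h‖ = 1 := by
  induction t with
  | zero => simp [stateAfter, A.norm_init]
  | succ t ih => simp [stateAfter, ih (by omega)]

/-- Final states of inputs with different answers are far from parallel. -/
theorem re_inner_stateAfter_le {f g : ListInput n k} (hf : 2 / 3 ≤ A.acceptProb f)
    (hg : A.acceptProb g ≤ 1 / 3) :
    (inner ℂ (A.stateAfter f T le_rfl) (A.stateAfter g T le_rfl)).re ≤ 17 / 18 := by
  set ψ := A.stateAfter f T le_rfl with hψ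
  set φ := A.stateAfter g T le_rfl with hφ
  have split (χ : QState n k A.w) (hχ : ‖χ‖ = 1) :
      ∑ x ∈ A.acceptᶜ, ‖χ x‖ ^ 2 = 1 - ∑ x ∈ A.accept, ‖χ x‖ ^ 2 := by
    have h := EuclideanSpace.norm_sq_eq χ
    rw [hχ, ← sum_add_sum_compl A.accept] at h
    linarith
  have hψ1 := split ψ (A.norm_stateAfter f T le_rfl)
  have hφ1 := split φ (A.norm_stateAfter g T le_rfl)
  have bound (s : Finset (BasisState n k A.w)) {a b : ℝ} (ha : 0 ≤ a) (hab : 1 ≤ a * b) :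
      ∑ x ∈ s, (inner ℂ (ψ x) (φ x)).re ≤
        (a * ∑ x ∈ s, ‖ψ x‖ ^ 2 + b * ∑ x ∈ s, ‖φ x‖ ^ 2) / 2 := by
    refine (sum_le_sum fun x _ => (le_abs_self _).trans
      (abs_re_inner_le_of_one_le_mul ha hab _ _)).trans_eq ?_
    rw [← sum_div, sum_add_distrib, ← mul_sum, ← mul_sum]
  -- Each half takes the smaller weight on the state that tends to be the larger there, so the gap
  -- between `2 / 3` and `1 / 3` leaves `17 / 18`.
  have h1 := bound A.accept (a := 2 / 3) (b := 3 / 2) (by norm_num) (by norm_num)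
  have h2 := bound A.acceptᶜ (a := 3 / 2) (b := 2 / 3) (by norm_num) (by norm_num)
  rw [re_inner_eq_sum, ← sum_add_sum_compl A.accept]
  rw [hψ1, hφ1] at h2
  unfold acceptProb at hf hg
  rw [← hψ] at hf
  rw [← hφ] at hg
  linarith

/-- The adversary bound for a family of pairs of inputs with different answers: if every query
lowers the sum of the inner products by at most `D`, then `T` queries need `T * D` to be at
least a constant fraction of the number of pairs. -/
theorem card_le_of_forall_sum_le {ι : Type*} [Fintype ι] (x y : ι → ListInput n k) (D : ℝ)
    (hx : ∀ r, 2 / 3 ≤ A.acceptProb (x r)) (hy : ∀ r, A.acceptProb (y r) ≤ 1 / 3)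
    (a b : ι → Fin n × Fin k → ℝ) (ha : ∀ r q, 0 ≤ a r q) (hb : ∀ r q, 0 ≤ b r q)
    (hab : ∀ r (q : Fin n × Fin k), x r q.1 q.2 ≠ y r q.1 q.2 → 1 ≤ a r q * b r q)
    (hD : ∀ ψ : ListInput n k → QState n k A.w, (∀ f, ‖ψ f‖ = 1) →
      ∑ r, ∑ q, (a r q * queryMass (ψ (x r)) q + b r q * queryMass (ψ (y r)) q) ≤ D) :
    (Fintype.card ι : ℝ) ≤ 18 * (T * D) := by
  have key : ∀ (t : ℕ) (h : t ≤ T), (Fintype.card ι : ℝ) -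
      ∑ r, (inner ℂ (A.stateAfter (x r) t h) (A.stateAfter (y r) t h)).re ≤ t * D := by
    intro t
    induction t with
    | zero =>
      intro h
      simp [stateAfter, inner_self_eq_norm_sq_to_K, A.norm_init]
    | succ t ih =>
      intro h
      have h1 := ih (by omega)
      have h2 := (sum_le_sum fun r (_ : r ∈ univ) => re_inner_sub_re_inner_oracle_le (x r) (y r)
        (A.stateAfter (x r) t (by omega)) (A.stateAfter (y r) t (by omega)) (a r) (b r) (ha r)
        (hb r) (hab r)).trans
        (hD (fun f => A.stateAfter f t (by omega)) fun f => A.norm_stateAfter f t _)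
      rw [sum_sub_distrib] at h2
      simp only [stateAfter, LinearIsometryEquiv.inner_map_map]
      push_cast
      linarith
  have h1 := key T le_rfl
  have h2 : ∑ r, (inner ℂ (A.stateAfter (x r) T le_rfl) (A.stateAfter (y r) T le_rfl)).re ≤
      ∑ _r : ι, (17 / 18 : ℝ) := sum_le_sum fun r _ => A.re_inner_stateAfter_le (hx r) (hy r)
  rw [sum_const, card_univ, nsmul_eq_mul] at h2
  linarith

end QueryAlgorithm

end ListModel

namespace ListModel

open Finset Relation

/-! ### The hard inputs: a permutation hidden among edges to hubs. -/

section PermInput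

variable {n k m : ℕ} [NeZero m] (hmn : m ≤ n)

/-- The vertex `m + i`, to which the `i`-th edges lead by default. -/
def hub (i : Fin k) : Fin n :=
  ⟨(m + i) % n, Nat.mod_lt _ ((NeZero.pos m).trans_le hmn)⟩

/-- The end of the special edge of `v`: vertices below `m` follow the permutation, the other ones
return to `0`. -/
def specialTarget (π : Equiv.Perm (Fin m)) (v : Fin n) : Fin n :=
  Fin.castLE hmn (if h : v.val < m then π ⟨v, h⟩ else 0)

/-- The number of the special edge of `v`. -/
def specialEdge (p : Fin m → Fin k) (v : Fin n) : ℕ :=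
  if h : v.val < m then p ⟨v, h⟩ else v - m

/-- The input in which the permutation `π` of the first `m` vertices is hidden among edges to the
other vertices: the edge `p v` of `v` leads to `π v`. -/
def permInput (π : Equiv.Perm (Fin m)) (p : Fin m → Fin k) : ListInput n k := fun v i =>
  if i.val = specialEdge p v then specialTarget hmn π v else hub hmn i

variable {hmn} {π σ : Equiv.Perm (Fin m)} {p p' : Fin m → Fin k}

theorem specialTarget_lt (v : Fin n) : (specialTarget hmn π v).val < m := by
  simp [specialTarget]

theorem specialTarget_castLE (v : Fin m) :
    specialTarget hmn π (Fin.castLE hmn v) = Fin.castLE hmn (π v) := by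
  simp [specialTarget]

theorem val_hub (h : m + k = n) (i : Fin k) : (hub hmn i).val = m + i :=
  Nat.mod_eq_of_lt (by have := i.isLt; omega)

theorem isSimple_permInput (hk : (2 ≤ k ∧ m + k = n) ∨ (k = 1 ∧ m = n)) :
    IsSimple (permInput hmn π p) := by
  intro u i j hij h
  have hij' : i.val ≠ j.val := fun h => hij (Fin.ext h)
  have hi := i.isLt
  have hj := j.isLt
  have hn : m + k = n := by omega
  have h' := congrArg Fin.val h
  have ht := specialTarget_lt (hmn := hmn) (π := π) u
  unfold permInput at h'
  split_ifs at h' <;> simp only [val_hub hn] at h' <;> omega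

theorem adj_specialTarget (hk : (2 ≤ k ∧ m + k = n) ∨ (k = 1 ∧ m = n)) (v : Fin n) :
    (graph (permInput hmn π p)).Adj v (specialTarget hmn π v) := by
  have h : specialEdge p v < k := by
    have := v.isLt
    unfold specialEdge
    split_ifs
    · exact Fin.isLt _
    · omega
  exact ⟨⟨_, h⟩, by simp [permInput]⟩

theorem adj_hub {v : Fin n} {i : Fin k} (h : i.val ≠ specialEdge p v) :
    (graph (permInput hmn π p)).Adj v (hub hmn i) :=
  ⟨i, by simp [permInput, h]⟩

/-- Every special edge ends in the core, which is connected by `π`. A hub is reached from `0`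
directly or, if its slot is the special one of `0`, through another hub; this needs `2 ≤ k`. -/
theorem stronglyConnected_permInput (hk : (2 ≤ k ∧ m + k = n) ∨ (k = 1 ∧ m = n))
    (hπ : ∀ a b : Fin m, ReflTransGen (fun x y => π x = y) a b) :
    StronglyConnected (graph (permInput hmn π p)) := by
  have hcore (a b : Fin m) : ReflTransGen (graph (permInput hmn π p)).Adj
      (Fin.castLE hmn a) (Fin.castLE hmn b) := by
    refine (hπ a b).lift (Fin.castLE hmn) ?_
    rintro x _ rfl
    rw [Function.onFun, ← specialTarget_castLE]
    exact adj_specialTarget hk _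
  have hfrom (s : Fin n) (b : Fin m) :
      ReflTransGen (graph (permInput hmn π p)).Adj s (Fin.castLE hmn b) :=
    (hcore _ b).head (adj_specialTarget hk s)
  intro s t
  by_cases ht : t.val < m
  · exact hfrom s ⟨t, ht⟩
  · have htn := t.isLt
    obtain ⟨hk2, hn⟩ : 2 ≤ k ∧ m + k = n := by omega
    have hval := val_hub (hmn := hmn) hn
    obtain ⟨i, rfl⟩ : ∃ i : Fin k, hub hmn i = t :=
      ⟨⟨t - m, by omega⟩, Fin.ext (by rw [hval]; simp; omega)⟩
    refine (hfrom s 0).trans ?_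
    by_cases hi : i.val = specialEdge p (Fin.castLE hmn (0 : Fin m))
    · obtain ⟨j, hj⟩ : ∃ j : Fin k, j.val ≠ i.val := by
        by_cases h0 : i.val = 0
        · exact ⟨⟨1, by omega⟩, by simp [h0]⟩
        · exact ⟨⟨0, by omega⟩, Ne.symm h0⟩
      refine (ReflTransGen.single (adj_hub (i := j) (by omega))).tail (adj_hub ?_)
      rw [specialEdge, hval, dif_neg (by omega)]
      omega
    · exact .single (adj_hub hi)

/-- Hubs return to the core only at `0`, so they give no way out of an invariant set containing `0`.
-/
theorem not_stronglyConnected_permInput (hk : (2 ≤ k ∧ m + k = n) ∨ (k = 1 ∧ m = n))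
    (S : Set (Fin m)) (hS : ∀ v ∈ S, π v ∈ S) (h0 : 0 ∈ S) {b : Fin m} (hb : b ∉ S) :
    ¬ StronglyConnected (graph (permInput hmn π p)) := by
  intro hsc
  have closed (t : Fin n)
      (h : ReflTransGen (graph (permInput hmn π p)).Adj (Fin.castLE hmn (0 : Fin m)) t) :
      ∀ ht : t.val < m, (⟨t, ht⟩ : Fin m) ∈ S := by
    induction h with
    | refl => exact fun _ => h0
    | @tail x y _ hxy ih =>
      intro hy
      obtain ⟨i, rfl⟩ := hxy
      by_cases hi : i.val = specialEdge p x
      · have h1 : permInput hmn π p x i = specialTarget hmn π x := by simp [permInput, hi]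
        simp only [h1, specialTarget]
        split_ifs with hx
        · exact hS _ (ih hx)
        · exact h0
      · have h1 : permInput hmn π p x i = hub hmn i := by simp [permInput, hi]
        rw [h1] at hy
        exfalso
        rcases hk with ⟨-, hn⟩ | ⟨h1, hn⟩
        · rw [val_hub hn] at hy
          omega
        -- For `k = 1` the only slot is the special one, so no edge leads to a hub.
        · have hi' := i.isLt
          have hx := x.isLt
          refine hi ?_
          rw [specialEdge, dif_pos (by omega)]
          have := (p ⟨x, by omega⟩).isLt
          omega
  exact hb (closed _ (hsc _ (Fin.castLE hmn b)) b.isLt)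

theorem exists_of_permInput_ne {u : Fin n} {i : Fin k}
    (h : permInput hmn π p u i ≠ permInput hmn σ p' u i) :
    ∃ v, Fin.castLE hmn v = u ∧ (π v ≠ σ v ∨ p v ≠ p' v) ∧ (i = p v ∨ i = p' v) := by
  by_cases hu : u.val < m
  · refine ⟨⟨u, hu⟩, rfl, ?_⟩
    obtain ⟨v, rfl⟩ : ∃ v, Fin.castLE hmn v = u := ⟨⟨u, hu⟩, rfl⟩
    simp only [permInput, specialEdge, specialTarget_castLE] at h
    simp only [Fin.val_castLE, Fin.is_lt, dite_true, Fin.eta] at h ⊢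
    simp only [← Fin.ext_iff] at h
    by_cases h1 : i = p v <;> by_cases h2 : i = p' v <;> simp [h1, h2] at h ⊢ <;> aesop
  · exact absurd (by simp [permInput, specialEdge, specialTarget, hu]) h

end PermInput

/-! ### One cycle cut into two, and hiding a point by relabelling. -/

section Rotation

variable {M d : ℕ}

/-- The permutation of `Fin (M + 1)` that rotates the block of the numbers below `d` and the block
of the other numbers. -/
def splitRotate (M d : ℕ) : Equiv.Perm (Fin (M + 1)) :=
  finRotate (M + 1) * Equiv.swap (Fin.ofNat (M + 1) (d - 1)) (Fin.last M)

theorem val_finRotate (x : Fin (M + 1)) :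
    (finRotate (M + 1) x).val = if x.val = M then 0 else x.val + 1 := by
  split_ifs with h
  · rw [show x = Fin.last M from Fin.ext h, finRotate_last]
    rfl
  · exact coe_finRotate_of_ne_last fun h' => h (by rw [h']; rfl)

theorem splitRotate_of_ne {x : Fin (M + 1)} (h1 : x ≠ Fin.ofNat (M + 1) (d - 1))
    (h2 : x ≠ Fin.last M) : splitRotate M d x = finRotate (M + 1) x := by
  rw [splitRotate, Equiv.Perm.mul_apply, Equiv.swap_apply_of_ne_of_ne h1 h2]

theorem val_splitRotate (hd : 0 < d) (hdM : d ≤ M) (x : Fin (M + 1)) :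
    (splitRotate M d x).val =
      if x.val = M then d else if x.val = d - 1 then 0 else x.val + 1 := by
  have hv : (Fin.ofNat (M + 1) (d - 1)).val = d - 1 := Nat.mod_eq_of_lt (by omega)
  by_cases h2 : x = Fin.last M
  · subst h2
    rw [splitRotate, Equiv.Perm.mul_apply, Equiv.swap_apply_right, val_finRotate, hv,
      if_neg (by omega), if_pos (by simp)]
    omega
  · have h2' : x.val ≠ M := fun h => h2 (Fin.ext h)
    rw [if_neg h2']
    by_cases h1 : x = Fin.ofNat (M + 1) (d - 1)
    · subst h1
      rw [splitRotate, Equiv.Perm.mul_apply, Equiv.swap_apply_left, if_pos hv, finRotate_last]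
      rfl
    · rw [splitRotate_of_ne h1 h2, val_finRotate, if_neg h2',
        if_neg fun h => h1 (Fin.ext (h.trans hv.symm))]

theorem splitRotate_lt_iff (hd : 0 < d) (hdM : d ≤ M) (x : Fin (M + 1)) :
    (splitRotate M d x).val < d ↔ x.val < d := by
  rw [val_splitRotate hd hdM]
  split_ifs <;> omega

theorem pow_apply_injOn_of_pow_apply_ne {α : Type*} (ρ : Equiv.Perm α) (z : α) (L : ℕ)
    (h : ∀ t, 0 < t → t < L → (ρ ^ t) z ≠ z) :
    Set.InjOn (fun t : ℕ => (ρ ^ t) z) (Finset.range L : Set ℕ) := by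
  have aux (s t : ℕ) (hst : s < t) (ht : t < L) : (ρ ^ s) z ≠ (ρ ^ t) z := by
    intro he
    refine h (t - s) (by omega) (by omega) ((ρ ^ s).injective ?_)
    rw [← Equiv.Perm.mul_apply, ← pow_add, he]
    congr 2
    omega
  intro s hs t ht he
  simp only [coe_range, Set.mem_Iio] at hs ht
  by_contra hne
  rcases Nat.lt_or_gt_of_ne hne with hlt | hlt
  · exact aux s t hlt ht he
  · exact aux t s hlt hs he.symm

theorem pow_finRotate_apply_zero (t : ℕ) (ht : t ≤ M) : (((finRotate (M + 1)) ^ t) 0).val = t := by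
  induction t with
  | zero => rfl
  | succ t ih =>
    rw [pow_succ', Equiv.Perm.mul_apply, val_finRotate, ih (by omega), if_neg (by omega)]

theorem pow_finRotate_injOn (z : Fin (M + 1)) :
    Set.InjOn (fun t : ℕ => ((finRotate (M + 1)) ^ t) z) (Finset.range (M + 1) : Set ℕ) := by
  obtain ⟨j, rfl⟩ : ∃ j : ℕ, ((finRotate (M + 1)) ^ j) 0 = z :=
    ⟨z, Fin.ext (pow_finRotate_apply_zero _ (by omega))⟩
  refine pow_apply_injOn_of_pow_apply_ne _ _ _ fun t h0 ht he => ?_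
  rw [← Equiv.Perm.mul_apply, ← pow_add, Nat.add_comm t j, pow_add, Equiv.Perm.mul_apply] at he
  have h1 := congrArg Fin.val (((finRotate (M + 1)) ^ j).injective he)
  rw [pow_finRotate_apply_zero t (by omega)] at h1
  simp at h1
  omega

theorem pow_splitRotate_apply_left (hd : 0 < d) (hdM : d ≤ M) (t : ℕ) (h0 : 0 < t) (ht : t ≤ d) :
    (((splitRotate M d) ^ t) (Fin.ofNat (M + 1) (d - 1))).val = t - 1 := by
  have hv : (Fin.ofNat (M + 1) (d - 1)).val = d - 1 := Nat.mod_eq_of_lt (by omega)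
  induction t, h0 using Nat.le_induction with
  | base =>
    rw [Nat.succ_eq_add_one, zero_add, pow_one, val_splitRotate hd hdM, hv, if_neg (by omega),
      if_pos rfl]
  | succ t h ih =>
    rw [pow_succ', Equiv.Perm.mul_apply, val_splitRotate hd hdM, ih (by omega),
      if_neg (by omega), if_neg (by omega)]
    omega

theorem pow_splitRotate_apply_last (hd : 0 < d) (hdM : d ≤ M) (t : ℕ) (h0 : 0 < t)
    (ht : t ≤ M + 1 - d) : (((splitRotate M d) ^ t) (Fin.last M)).val = d + t - 1 := by
  induction t, h0 using Nat.le_induction with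
  | base =>
    rw [Nat.succ_eq_add_one, zero_add, pow_one, val_splitRotate hd hdM, if_pos (by simp)]
    omega
  | succ t h ih =>
    rw [pow_succ', Equiv.Perm.mul_apply, val_splitRotate hd hdM, ih (by omega),
      if_neg (by omega), if_neg (by omega)]
    omega

theorem pow_splitRotate_injOn_left (hd : 0 < d) (hdM : d ≤ M) :
    Set.InjOn (fun t : ℕ => ((splitRotate M d) ^ t) (Fin.ofNat (M + 1) (d - 1)))
      (Finset.range d : Set ℕ) := by
  have hv : (Fin.ofNat (M + 1) (d - 1)).val = d - 1 := Nat.mod_eq_of_lt (by omega)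
  refine pow_apply_injOn_of_pow_apply_ne _ _ _ fun t h0 ht he => ?_
  have h1 := congrArg Fin.val he
  rw [pow_splitRotate_apply_left hd hdM t h0 (by omega), hv] at h1
  omega

theorem pow_splitRotate_injOn_last (hd : 0 < d) (hdM : d ≤ M) :
    Set.InjOn (fun t : ℕ => ((splitRotate M d) ^ t) (Fin.last M))
      (Finset.range (M + 1 - d) : Set ℕ) := by
  refine pow_apply_injOn_of_pow_apply_ne _ _ _ fun t h0 ht he => ?_
  have h1 := congrArg Fin.val he
  rw [pow_splitRotate_apply_last hd hdM t h0 (by omega), Fin.val_last] at h1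
  omega

/-- Relabelled by a random permutation `e`, a point `e z` is hidden from anything that sees only
the conjugate of `ρ`, to the extent of the length of the cycle of `z`. -/
theorem mul_sum_conj_le {α : Type*} [Fintype α] [DecidableEq α] (ρ : Equiv.Perm α) (z : α) (L : ℕ)
    (hinj : Set.InjOn (fun t : ℕ => (ρ ^ t) z) (Finset.range L : Set ℕ))
    (R : Equiv.Perm α → α → ℝ) (h0 : ∀ π v, 0 ≤ R π v) (h1 : ∀ π, ∑ v, R π v ≤ 1) :
    L * ∑ e : Equiv.Perm α, R (e * ρ * e⁻¹) (e z) ≤ Fintype.card (Equiv.Perm α) := by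
  -- Substitute `e * ρ ^ t` for `e`: as `ρ ^ t` commutes with `ρ`, the conjugate stays the same.
  have shift (t : ℕ) : ∑ e : Equiv.Perm α, R (e * ρ * e⁻¹) (e z) =
      ∑ e : Equiv.Perm α, R (e * ρ * e⁻¹) (e ((ρ ^ t) z)) := by
    refine (Fintype.sum_equiv (Equiv.mulRight (ρ ^ t)) _ _ fun e => ?_).symm
    simp only [Equiv.coe_mulRight, mul_inv_rev, Equiv.Perm.mul_apply]
    congr 1
    rw [mul_assoc e (ρ ^ t) ρ, (Commute.self_pow ρ t).symm.eq, mul_assoc, mul_assoc, mul_assoc,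
      mul_inv_cancel_left]
  calc L * ∑ e : Equiv.Perm α, R (e * ρ * e⁻¹) (e z)
      = ∑ t ∈ range L, ∑ e : Equiv.Perm α, R (e * ρ * e⁻¹) (e ((ρ ^ t) z)) := by
        rw [sum_congr rfl fun t _ => (shift t).symm, sum_const, card_range, nsmul_eq_mul]
    _ = ∑ e : Equiv.Perm α, ∑ t ∈ range L, R (e * ρ * e⁻¹) (e ((ρ ^ t) z)) := sum_comm
    _ ≤ ∑ _e : Equiv.Perm α, (1 : ℝ) := by
        refine sum_le_sum fun e _ => le_trans ?_ (h1 (e * ρ * e⁻¹))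
        rw [← sum_image (f := fun v => R (e * ρ * e⁻¹) v) (g := fun t : ℕ => e ((ρ ^ t) z))
          fun s hs t ht he => hinj hs ht (e.injective he)]
        exact sum_le_sum_of_subset_of_nonneg (subset_univ _) fun v _ _ => h0 _ v
    _ = Fintype.card (Equiv.Perm α) := by simp

end Rotation

end ListModel

namespace ListModel

open Finset Relation

/-! ### Average query weight on the entries where a pair differs. -/

section Adversary

variable {n k w M d : ℕ}

/-- The weight that a state puts on querying the edges of `u`. -/
noncomputable def rowMass (ψ : QState n k w) (u : Fin n) : ℝ :=
  ∑ i, queryMass ψ (u, i)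

theorem rowMass_nonneg (ψ : QState n k w) (u : Fin n) : 0 ≤ rowMass ψ u :=
  sum_nonneg fun _ _ => queryMass_nonneg _ _

theorem queryMass_le_rowMass (ψ : QState n k w) (u : Fin n) (i : Fin k) :
    queryMass ψ (u, i) ≤ rowMass ψ u :=
  single_le_sum (f := fun i => queryMass ψ (u, i)) (fun _ _ => queryMass_nonneg _ _) (mem_univ i)

theorem sum_rowMass_castLE_le {m : ℕ} (hmn : m ≤ n) {ψ : QState n k w} (hψ : ‖ψ‖ = 1) :
    ∑ v : Fin m, rowMass ψ (Fin.castLE hmn v) ≤ 1 := by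
  have h : ∑ u, rowMass ψ u = 1 := by
    have h := sum_queryMass ψ
    rwa [hψ, Fintype.sum_prod_type, one_pow] at h
  rw [← h, ← sum_image (f := rowMass ψ) (g := Fin.castLE hmn)
    fun _ _ _ _ he => Fin.castLE_injective hmn he]
  exact sum_le_sum_of_subset_of_nonneg (subset_univ _) fun v _ _ => rowMass_nonneg ψ v

variable (hmn : M + 1 ≤ n) (ψ : ListInput n k → QState n k w) (ρ : Equiv.Perm (Fin (M + 1)))

/-- The number of pairs of a permutation and a placement of the special edges. -/
noncomputable def numPlaced (M k : ℕ) : ℝ :=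
  Fintype.card (Equiv.Perm (Fin (M + 1))) * Fintype.card (Fin (M + 1) → Fin k)

variable {ψ ρ}

theorem mul_sum_rowMass_le (hψ : ∀ f, ‖ψ f‖ = 1) (z : Fin (M + 1)) (L : ℕ)
    (hinj : Set.InjOn (fun t : ℕ => (ρ ^ t) z) (range L : Set ℕ)) :
    L * ∑ e : Equiv.Perm (Fin (M + 1)), ∑ p : Fin (M + 1) → Fin k,
      rowMass (ψ (permInput hmn (e * ρ * e⁻¹) p)) (Fin.castLE hmn (e z)) ≤ numPlaced M k := by
  rw [sum_comm, mul_sum]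
  refine (sum_le_sum fun p _ => mul_sum_conj_le ρ z L hinj
    (fun π v => rowMass (ψ (permInput hmn π p)) (Fin.castLE hmn v))
    (fun _ _ => rowMass_nonneg _ _) fun π => sum_rowMass_castLE_le hmn (hψ _)).trans_eq ?_
  rw [sum_const, card_univ, nsmul_eq_mul, mul_comm]
  rfl

/-- The input may reveal `p (e z)`, so only the row is hidden and the idle sum over `s` costs a
factor `k`. -/
theorem mul_sum_queryMass_special_le (hψ : ∀ f, ‖ψ f‖ = 1) (z : Fin (M + 1)) (L : ℕ)
    (hinj : Set.InjOn (fun t : ℕ => (ρ ^ t) z) (range L : Set ℕ)) :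
    L * ∑ e : Equiv.Perm (Fin (M + 1)), ∑ p : Fin (M + 1) → Fin k, ∑ _s : Fin k,
      queryMass (ψ (permInput hmn (e * ρ * e⁻¹) p)) (Fin.castLE hmn (e z), p (e z)) ≤
      k * numPlaced M k := by
  refine le_trans ?_
    (mul_le_mul_of_nonneg_left (mul_sum_rowMass_le hmn hψ z L hinj) (Nat.cast_nonneg k))
  rw [mul_left_comm (k : ℝ)]
  simp only [mul_sum (a := (k : ℝ)), sum_const, card_univ, nsmul_eq_mul, Fintype.card_fin]
  gcongr
  exact queryMass_le_rowMass _ _ _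

/-- The input does not depend on `s`, so the sum over `s` sweeps the row once and no factor `k`
appears. -/
theorem mul_sum_queryMass_shift_le [NeZero k] (hψ : ∀ f, ‖ψ f‖ = 1) (z : Fin (M + 1)) (L : ℕ)
    (hinj : Set.InjOn (fun t : ℕ => (ρ ^ t) z) (range L : Set ℕ)) :
    L * ∑ e : Equiv.Perm (Fin (M + 1)), ∑ p : Fin (M + 1) → Fin k, ∑ s : Fin k,
      queryMass (ψ (permInput hmn (e * ρ * e⁻¹) p)) (Fin.castLE hmn (e z), p (e z) + s) ≤
      numPlaced M k := by
  refine le_of_eq_of_le ?_ (mul_sum_rowMass_le hmn hψ z L hinj)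
  congr 1
  refine sum_congr rfl fun e _ => sum_congr rfl fun p _ => ?_
  exact Fintype.sum_equiv (Equiv.addLeft (p (e z))) _ _ fun _ => rfl

/-- The change of the placement of the special edges: those of the vertices `e z` with `z ∈ Z` are
moved by `s`. -/
def moveEdges (Z : Finset (Fin (M + 1))) [NeZero k] (e : Equiv.Perm (Fin (M + 1))) (s : Fin k) :
    Fin (M + 1) → Fin k :=
  fun v => if e.symm v ∈ Z then s else 0

variable {Z : Finset (Fin (M + 1))}

theorem moveEdges_apply [NeZero k] {z : Fin (M + 1)} (hz : z ∈ Z)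
    (e : Equiv.Perm (Fin (M + 1))) (s : Fin k) :
    moveEdges Z e s (e z) = s := by
  simp [moveEdges, hz]

/-- For fixed `e` and `s`, moving the edges is a translation of `p`; it reduces the second input of
a pair to the form of the first. -/
theorem sum_moved_special [NeZero k] {z : Fin (M + 1)} (hz : z ∈ Z) :
    ∑ e : Equiv.Perm (Fin (M + 1)), ∑ p : Fin (M + 1) → Fin k, ∑ s : Fin k,
      queryMass (ψ (permInput hmn (e * ρ * e⁻¹) (p + moveEdges Z e s)))
        (Fin.castLE hmn (e z), p (e z) + s) =
    ∑ e : Equiv.Perm (Fin (M + 1)), ∑ p : Fin (M + 1) → Fin k, ∑ _s : Fin k,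
      queryMass (ψ (permInput hmn (e * ρ * e⁻¹) p)) (Fin.castLE hmn (e z), p (e z)) := by
  refine sum_congr rfl fun e _ => ?_
  rw [sum_comm, sum_comm (s := univ (α := Fin (M + 1) → Fin k))]
  refine sum_congr rfl fun s _ => ?_
  refine Fintype.sum_equiv (Equiv.addRight (moveEdges Z e s)) _ _ fun p => ?_
  simp [moveEdges_apply hz]

/-- The same translation turns the slot into `p (e z) - s`; then `s` is replaced by `-s`. -/
theorem sum_moved_shift [NeZero k] {z : Fin (M + 1)} (hz : z ∈ Z) :
    ∑ e : Equiv.Perm (Fin (M + 1)), ∑ p : Fin (M + 1) → Fin k, ∑ s : Fin k,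
      queryMass (ψ (permInput hmn (e * ρ * e⁻¹) (p + moveEdges Z e s)))
        (Fin.castLE hmn (e z), p (e z)) =
    ∑ e : Equiv.Perm (Fin (M + 1)), ∑ p : Fin (M + 1) → Fin k, ∑ s : Fin k,
      queryMass (ψ (permInput hmn (e * ρ * e⁻¹) p)) (Fin.castLE hmn (e z), p (e z) + s) := by
  refine sum_congr rfl fun e _ => ?_
  rw [sum_comm]
  refine .trans ?_ (sum_congr rfl fun p _ => Fintype.sum_equiv (Equiv.neg (Fin k))
    (fun s => queryMass (ψ (permInput hmn (e * ρ * e⁻¹) p))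
      (Fin.castLE hmn (e z), p (e z) - s)) _ fun s => by simp [sub_eq_add_neg])
  rw [sum_comm (s := univ (α := Fin (M + 1) → Fin k))]
  refine sum_congr rfl fun s _ => ?_
  refine Fintype.sum_equiv (Equiv.addRight (moveEdges Z e s)) _ _ fun p => ?_
  simp [moveEdges_apply hz]

/-- The function on the entries of the input that is `α` at the special edges of the vertices
`e z` with `z ∈ Z` and `β` at the edges shifted from them by `s`. -/
noncomputable def edgeWeight (Z : Finset (Fin (M + 1))) (e : Equiv.Perm (Fin (M + 1)))
    (p : Fin (M + 1) → Fin k) (s : Fin k) (α β : ℝ) (q : Fin n × Fin k) : ℝ :=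
  ∑ z ∈ Z, ((if q = (Fin.castLE hmn (e z), p (e z)) then α else 0) +
    if q = (Fin.castLE hmn (e z), p (e z) + s) then β else 0)

variable {e : Equiv.Perm (Fin (M + 1))} {p : Fin (M + 1) → Fin k} {s : Fin k} {α β : ℝ}

theorem edgeWeight_term_nonneg (hα : 0 ≤ α) (hβ : 0 ≤ β) (q : Fin n × Fin k) (z : Fin (M + 1)) :
    0 ≤ (if q = (Fin.castLE hmn (e z), p (e z)) then α else 0) +
      if q = (Fin.castLE hmn (e z), p (e z) + s) then β else 0 := by
  split_ifs <;> positivity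

theorem edgeWeight_nonneg (hα : 0 ≤ α) (hβ : 0 ≤ β) (q : Fin n × Fin k) :
    0 ≤ edgeWeight hmn Z e p s α β q :=
  sum_nonneg fun z _ => edgeWeight_term_nonneg hmn hα hβ q z

theorem le_edgeWeight_special (hα : 0 ≤ α) (hβ : 0 ≤ β) {z : Fin (M + 1)} (hz : z ∈ Z) :
    α ≤ edgeWeight hmn Z e p s α β (Fin.castLE hmn (e z), p (e z)) := by
  refine le_trans ?_ (single_le_sum (fun z _ => edgeWeight_term_nonneg hmn hα hβ _ z) hz)
  rw [if_pos rfl]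
  split_ifs <;> linarith

theorem le_edgeWeight_shift (hα : 0 ≤ α) (hβ : 0 ≤ β) {z : Fin (M + 1)} (hz : z ∈ Z) :
    β ≤ edgeWeight hmn Z e p s α β (Fin.castLE hmn (e z), p (e z) + s) := by
  refine le_trans ?_ (single_le_sum (fun z _ => edgeWeight_term_nonneg hmn hα hβ _ z) hz)
  rw [if_pos (rfl : (Fin.castLE hmn (e z), p (e z) + s) = _)]
  split_ifs <;> linarith

theorem sum_edgeWeight_mul (φ : QState n k w) :
    ∑ q, edgeWeight hmn Z e p s α β q * queryMass φ q =
      ∑ z ∈ Z, (α * queryMass φ (Fin.castLE hmn (e z), p (e z)) +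
        β * queryMass φ (Fin.castLE hmn (e z), p (e z) + s)) := by
  simp only [edgeWeight, sum_mul]
  rw [sum_comm]
  refine sum_congr rfl fun z _ => ?_
  simp only [add_mul, sum_add_distrib, ite_mul, zero_mul, sum_ite_eq', mem_univ, if_true]

/-- The two weights are reciprocal at both slots; extra terms, as when `s = 0`, only increase them.
-/
theorem one_le_edgeWeight_mul [NeZero k] {τ : Equiv.Perm (Fin (M + 1))} (hτ : ∀ z, z ∉ Z → ρ z = τ z)
    (hα : 0 < α) {q : Fin n × Fin k}
    (hq : permInput hmn (e * ρ * e⁻¹) p q.1 q.2 ≠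
      permInput hmn (e * τ * e⁻¹) (p + moveEdges Z e s) q.1 q.2) :
    1 ≤ edgeWeight hmn Z e p s α⁻¹ α q * edgeWeight hmn Z e p s α α⁻¹ q := by
  obtain ⟨v, hv, hne, hi⟩ := exists_of_permInput_ne hq
  obtain ⟨z, rfl⟩ := e.surjective v
  have hz : z ∈ Z := by
    by_contra hz
    simp [moveEdges, hz, hτ z hz] at hne
  rw [Pi.add_apply, moveEdges_apply hz] at hi
  have hα' : 0 < α⁻¹ := inv_pos.2 hα
  rcases hi with hi | hi
  · rw [show q = (Fin.castLE hmn (e z), p (e z)) from Prod.ext hv.symm hi]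
    have h := mul_le_mul (le_edgeWeight_special hmn (e := e) (p := p) (s := s) hα'.le hα.le hz)
      (le_edgeWeight_special hmn (e := e) (p := p) (s := s) hα.le hα'.le hz) hα.le
      (edgeWeight_nonneg hmn hα'.le hα.le _)
    rwa [inv_mul_cancel₀ hα.ne'] at h
  · rw [show q = (Fin.castLE hmn (e z), p (e z) + s) from Prod.ext hv.symm hi]
    have h := mul_le_mul (le_edgeWeight_shift hmn (e := e) (p := p) (s := s) hα'.le hα.le hz)
      (le_edgeWeight_shift hmn (e := e) (p := p) (s := s) hα.le hα'.le hz) hα'.le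
      (edgeWeight_nonneg hmn hα'.le hα.le _)
    rwa [mul_inv_cancel₀ hα.ne'] at h

/-- Hiding a difference of two permutations at the points of `Z` costs
`Ω(L √k / |Z|)` queries when `L` points of the cycles of `Z` cannot be told apart. -/
theorem sqrt_mul_le_of_perm_pair [NeZero k] {T : ℕ} (A : QueryAlgorithm n k T)
    {ρ τ : Equiv.Perm (Fin (M + 1))} (hτ : ∀ z, z ∉ Z → ρ z = τ z) {L : ℕ} (hL : 0 < L)
    (hρL : ∀ z ∈ Z, Set.InjOn (fun t : ℕ => (ρ ^ t) z) (range L : Set ℕ))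
    (hτL : ∀ z ∈ Z, Set.InjOn (fun t : ℕ => (τ ^ t) z) (range L : Set ℕ))
    (hx : ∀ (e : Equiv.Perm (Fin (M + 1))) p, 2 / 3 ≤ A.acceptProb (permInput hmn (e * ρ * e⁻¹) p))
    (hy : ∀ (e : Equiv.Perm (Fin (M + 1))) p,
      A.acceptProb (permInput hmn (e * τ * e⁻¹) p) ≤ 1 / 3) :
    L * Real.sqrt k ≤ 72 * #Z * T := by
  have hk : (0 : ℝ) < k := Nat.cast_pos.2 (NeZero.pos k)
  have hL' : (0 : ℝ) < L := Nat.cast_pos.2 hL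
  set c := Real.sqrt k with hc
  have hc0 : 0 < c := Real.sqrt_pos.2 hk
  have hcc : c * c = k := Real.mul_self_sqrt hk.le
  have hN : 0 < numPlaced M k := by
    unfold numPlaced
    have : 0 < Fintype.card (Fin (M + 1) → Fin k) := Fintype.card_pos
    have : 0 < Fintype.card (Equiv.Perm (Fin (M + 1))) := Fintype.card_pos
    positivity
  have h := A.card_le_of_forall_sum_le
    (ι := Equiv.Perm (Fin (M + 1)) × (Fin (M + 1) → Fin k) × Fin k)
    (fun r => permInput hmn (r.1 * ρ * r.1⁻¹) r.2.1)
    (fun r => permInput hmn (r.1 * τ * r.1⁻¹) (r.2.1 + moveEdges Z r.1 r.2.2))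
    -- Each point of `Z` gives four terms, two slots in two inputs, each at most `c * numPlaced M k
    -- / L` because `c⁻¹ * k = c`.
    (#Z * (4 * c * numPlaced M k / L)) (fun r => hx _ _) (fun r => hy _ _)
    (fun r => edgeWeight hmn Z r.1 r.2.1 r.2.2 c⁻¹ c)
    (fun r => edgeWeight hmn Z r.1 r.2.1 r.2.2 c c⁻¹)
    (fun r => edgeWeight_nonneg hmn (inv_nonneg.2 hc0.le) hc0.le)
    (fun r => edgeWeight_nonneg hmn hc0.le (inv_nonneg.2 hc0.le))
    (fun r q hq => one_le_edgeWeight_mul hmn hτ hc0 hq) ?_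
  · simp only [Fintype.card_prod, Fintype.card_fin, Nat.cast_mul, ← mul_assoc] at h
    change numPlaced M k * (k : ℝ) ≤ _ at h
    rw [← hcc] at h
    have h2 : 18 * (T : ℝ) * #Z * (4 * c * numPlaced M k / L) =
        (numPlaced M k * c) * (72 * #Z * T / L) := by ring
    have h3 : (numPlaced M k * c) * c ≤ (numPlaced M k * c) * (72 * #Z * T / L) := by
      rw [← h2]
      refine le_trans (by linarith) (h.trans_eq (by ring))
    have h4 := le_of_mul_le_mul_left h3 (mul_pos hN hc0)
    rw [le_div_iff₀ hL'] at h4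
    linarith
  · intro ψ hψ
    simp only [sum_add_distrib, sum_edgeWeight_mul]
    simp only [sum_comm (t := Z), ← mul_sum, Fintype.sum_prod_type]
    simp only [mul_sum (s := Z)]
    rw [← sum_add_distrib, ← sum_add_distrib, ← sum_add_distrib, ← nsmul_eq_mul]
    refine sum_le_card_nsmul _ _ _ fun z hz => ?_
    rw [sum_moved_special hmn hz, sum_moved_shift hmn hz]
    have h1 := mul_sum_queryMass_special_le hmn (k := k) hψ z L (hρL z hz)
    have h2 := mul_sum_queryMass_shift_le hmn (k := k) hψ z L (hρL z hz)
    have h3 := mul_sum_queryMass_special_le hmn (k := k) hψ z L (hτL z hz)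
    have h4 := mul_sum_queryMass_shift_le hmn (k := k) hψ z L (hτL z hz)
    rw [← hcc] at h1 h3
    rw [le_div_iff₀ hL']
    have h1' := mul_le_mul_of_nonneg_left h1 (inv_nonneg.2 hc0.le)
    have h3' := mul_le_mul_of_nonneg_left h3 (inv_nonneg.2 hc0.le)
    have h2' := mul_le_mul_of_nonneg_left h2 hc0.le
    have h4' := mul_le_mul_of_nonneg_left h4 hc0.le
    have hs : c⁻¹ * (c * c * numPlaced M k) = c * numPlaced M k := by
      field_simp
    rw [hs] at h1' h3'
    linarith

end Adversary

/-! ### The query bound for strong connectivity. -/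

section StrongConnectivity

variable {n k M d T : ℕ}

theorem reflTransGen_pow_apply {α : Type*} (π : Equiv.Perm α) (a : α) (t : ℕ) :
    ReflTransGen (fun x y => π x = y) a ((π ^ t) a) := by
  induction t with
  | zero => exact .refl
  | succ t ih => exact ih.tail (by rw [pow_succ', Equiv.Perm.mul_apply])

theorem reflTransGen_conj_finRotate (e : Equiv.Perm (Fin (M + 1))) (a b : Fin (M + 1)) :
    ReflTransGen (fun x y => (e * finRotate (M + 1) * e⁻¹) x = y) a b := by
  have hsurj : (range (M + 1)).image (fun t : ℕ => (finRotate (M + 1) ^ t) (e.symm a)) = univ := by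
    refine eq_univ_of_card _ ?_
    rw [card_image_of_injOn (pow_finRotate_injOn _), card_range, Fintype.card_fin]
  obtain ⟨t, -, ht⟩ := mem_image.1 (hsurj ▸ mem_univ (e.symm b))
  have h := reflTransGen_pow_apply (e * finRotate (M + 1) * e⁻¹) a t
  rw [conj_pow] at h
  change ReflTransGen _ a (e ((finRotate (M + 1) ^ t) (e.symm a))) at h
  rwa [ht, Equiv.apply_symm_apply] at h

theorem not_stronglyConnected_splitRotate (hmn : M + 1 ≤ n)
    (hk : (2 ≤ k ∧ M + 1 + k = n) ∨ (k = 1 ∧ M + 1 = n)) (hd : 0 < d) (hdM : d ≤ M)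
    (e : Equiv.Perm (Fin (M + 1))) (p : Fin (M + 1) → Fin k) :
    ¬ StronglyConnected (graph (permInput hmn (e * splitRotate M d * e⁻¹) p)) := by
  refine not_stronglyConnected_permInput hk
    -- The relabelled block that contains `0`; the witness outside it comes from the other block.
    {v | (e.symm v).val < d ↔ (e.symm 0).val < d} ?_ Iff.rfl
    (b := e (if (e.symm 0).val < d then Fin.last M else 0)) ?_
  · intro v hv
    simpa [splitRotate_lt_iff hd hdM] using hv
  · rw [Set.mem_ofPred_eq, Equiv.symm_apply_apply]
    split_ifs with h
    · simp only [h, Fin.val_last, iff_true]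
      omega
    · simp only [h, iff_false, not_not]
      exact hd

theorem sqrt_mul_le_of_decides (A : QueryAlgorithm n k T) (hA : A.DecidesStrongConnectivity)
    (hM : 0 < M) (hk : (2 ≤ k ∧ M + 1 + k = n) ∨ (k = 1 ∧ M + 1 = n)) :
    ((M + 1 : ℕ) : ℝ) * Real.sqrt k ≤ 432 * T := by
  have hmn : M + 1 ≤ n := by omega
  have : NeZero k := ⟨by omega⟩
  -- Halving makes both cycles at least `d` long, with `d` at least a third of the core. The
  -- constant is `432 = 72 * 2 * 3`.
  obtain ⟨d, hd, hdM, hd2, hd3⟩ : ∃ d, 0 < d ∧ d ≤ M ∧ d ≤ M + 1 - d ∧ M + 1 ≤ 3 * d :=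
    ⟨(M + 1) / 2, by omega, by omega, by omega, by omega⟩
  have hmono {N : ℕ} (h : d ≤ N) : (range d : Set ℕ) ⊆ range N := by
    exact_mod_cast range_subset_range.2 h
  have h := sqrt_mul_le_of_perm_pair (Z := {Fin.ofNat (M + 1) (d - 1), Fin.last M}) hmn A
    (ρ := finRotate (M + 1)) (τ := splitRotate M d)
    (fun z hz => by
      simp only [mem_insert, mem_singleton, not_or] at hz
      exact (splitRotate_of_ne hz.1 hz.2).symm) hd
    (fun z _ => (pow_finRotate_injOn z).mono (hmono (by omega)))
    (fun z hz => by
      simp only [mem_insert, mem_singleton] at hz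
      rcases hz with rfl | rfl
      · exact pow_splitRotate_injOn_left hd hdM
      · exact (pow_splitRotate_injOn_last hd hdM).mono (hmono hd2))
    (fun e p => (hA _ (isSimple_permInput hk)).1
      (stronglyConnected_permInput hk (reflTransGen_conj_finRotate e)))
    (fun e p => (hA _ (isSimple_permInput hk)).2
      (not_stronglyConnected_splitRotate hmn hk hd hdM e p))
  have hZ : ((#{Fin.ofNat (M + 1) (d - 1), Fin.last M} : ℕ) : ℝ) ≤ 2 := by
    exact_mod_cast card_le_two
  have hd3' : ((M + 1 : ℕ) : ℝ) ≤ 3 * d := by exact_mod_cast hd3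
  have h1 := mul_le_mul_of_nonneg_right hd3' (Real.sqrt_nonneg k)
  have h2 := mul_le_mul_of_nonneg_right hZ (Nat.cast_nonneg (α := ℝ) T)
  linarith

/-- Without queries the acceptance probability ignores the input. A circulant graph with all edges
`v → v + 1` and a graph in which no edge enters `0` need different answers. -/
theorem pos_of_decides (A : QueryAlgorithm n k T) (hA : A.DecidesStrongConnectivity)
    (hk : 1 ≤ k) (hkn : k < n) : 0 < T := by
  have : NeZero n := ⟨by omega⟩
  rcases Nat.eq_zero_or_pos T with rfl | hT
  · exfalso
    have hyes : 2 / 3 ≤ A.acceptProb fun v i => v + 1 + Fin.castLE hkn.le i := by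
      refine (hA _ ?_).1 ?_
      · intro u i j hij h
        exact hij (Fin.castLE_injective hkn.le (add_left_cancel h))
      · intro s t
        have hreach (j : ℕ) : ReflTransGen
            (graph fun (v : Fin n) (i : Fin k) => v + 1 + Fin.castLE hkn.le i).Adj
            s (s + Fin.ofNat n j) := by
          induction j with
          | zero => simpa using ReflTransGen.refl
          | succ j ih =>
            refine ih.tail ⟨⟨0, hk⟩, ?_⟩
            have h0 : Fin.castLE hkn.le ⟨0, hk⟩ = (0 : Fin n) := rfl
            simp only [h0, add_zero, Fin.ofNat_eq_cast, add_assoc]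
            congr 1
            exact Fin.ext (by simp [Fin.val_add])
        simpa using hreach (t - s).val
    have hno : A.acceptProb (fun _ i => ⟨i.val + 1, by omega⟩) ≤ 1 / 3 := by
      refine (hA _ ?_).2 ?_
      · intro u i j hij h
        exact hij (Fin.ext (by simpa using congrArg Fin.val h))
      · intro hsc
        obtain h | ⟨y, -, i, hi⟩ := (ReflTransGen.cases_tail_iff _ _ _).1
          (hsc ⟨1, by omega⟩ ⟨0, by omega⟩)
        · simp at h
        · simp at hi
    have : (2 / 3 : ℝ) ≤ 1 / 3 := hyes.trans hno
    norm_num at this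
  · exact hT

theorem le_queries_of_decides {ε : ℝ} (hε : 0 < ε) (A : QueryAlgorithm n k T)
    (hA : A.DecidesStrongConnectivity) (hk : 1 ≤ k) (hkn : (k : ℝ) ≤ (1 - ε) * n) :
    ε ^ 2 / 432 * (n * Real.sqrt k) ≤ T := by
  have hk' : (1 : ℝ) ≤ k := by exact_mod_cast hk
  have hn0 : (0 : ℝ) < n := by
    rcases Nat.eq_zero_or_pos n with rfl | h
    · simp at hkn; linarith
    · exact_mod_cast h
  have hε1 : ε ≤ 1 := by
    by_contra h
    have := mul_neg_of_neg_of_pos (by linarith : 1 - ε < 0) hn0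
    linarith
  have hlt : k < n := by
    have := mul_pos hε hn0
    exact_mod_cast (by linarith : (k : ℝ) < n)
  have hc := Real.sqrt_nonneg k
  have main (M : ℕ) (hM : 0 < M) (h : (2 ≤ k ∧ M + 1 + k = n) ∨ (k = 1 ∧ M + 1 = n))
      (hMn : ε * n ≤ (M + 1 : ℕ)) : ε ^ 2 / 432 * (n * Real.sqrt k) ≤ T := by
    have h1 := sqrt_mul_le_of_decides A hA hM h
    have h2 := mul_le_mul_of_nonneg_right hMn hc
    -- The core size uses one factor `ε`; the other is given away by `ε ≤ 1`.
    have h3 : ε * (ε * n * Real.sqrt k) ≤ 1 * (ε * n * Real.sqrt k) := by gcongr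
    nlinarith
  by_cases hk1 : k = 1
  · refine main (n - 1) (by omega) (.inr ⟨hk1, by omega⟩) ?_
    rw [Nat.sub_add_cancel (by omega)]
    nlinarith
  · have hnk : ε * n ≤ (n - k : ℕ) := by
      rw [Nat.cast_sub hlt.le]
      linarith
    -- A core of one vertex cannot be split. But then `ε * n ≤ 1`, so `ε ^ 2 * n * √k ≤ 1` and one
    -- query suffices for the bound; this is where `ε ^ 2` is needed.
    by_cases h1 : n - k = 1
    · rw [h1, Nat.cast_one] at hnk
      have hT : (1 : ℝ) ≤ T := by exact_mod_cast pos_of_decides A hA hk hlt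
      have hsq : Real.sqrt k ≤ n := by
        have hkn' : (k : ℝ) ≤ n := by exact_mod_cast hlt.le
        rw [Real.sqrt_le_left hn0.le]
        nlinarith
      have h2 : (n : ℝ) * Real.sqrt k ≤ n * n := by gcongr
      have h3 : ε ^ 2 * (n * Real.sqrt k) ≤ ε ^ 2 * (n * n) := by gcongr
      have h4 : (ε * n) * (ε * n) ≤ 1 * 1 := by gcongr
      nlinarith
    · refine main (n - k - 1) (by omega) (.inl ⟨by omega, by omega⟩) ?_
      rwa [Nat.sub_add_cancel (by omega)]

theorem ofReal_le_strongConnectivityComplexity {x : ℝ}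
    (h : ∀ (T : ℕ) (A : QueryAlgorithm n k T), A.DecidesStrongConnectivity → x ≤ T) :
    ENNReal.ofReal x ≤ ((strongConnectivityComplexity n k : ℕ∞) : ℝ≥0∞) := by
  have h1 : ((⌈x⌉₊ : ℕ) : ℕ∞) ≤ strongConnectivityComplexity n k :=
    le_iInf₂ fun T ⟨A, hA⟩ => by exact_mod_cast Nat.ceil_le.2 (h T A hA)
  calc ENNReal.ofReal x ≤ ENNReal.ofReal (⌈x⌉₊ : ℕ) := ENNReal.ofReal_le_ofReal (Nat.le_ceil x)
    _ = (((⌈x⌉₊ : ℕ) : ℕ∞) : ℝ≥0∞) := by simp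
    _ ≤ _ := ENat.toENNReal_le.2 h1

end StrongConnectivity

end ListModel

theorem mainTheorem4 (ε : ℝ) (hε : 0 < ε) :
    ∃ c : ℝ, 0 < c ∧ ∀ n k : ℕ, 1 ≤ k → (k : ℝ) ≤ (1 - ε) * n →
      ENNReal.ofReal (c * (n * Real.sqrt k)) ≤
        ((ListModel.strongConnectivityComplexity n k : ℕ∞) : ℝ≥0∞) :=
  ⟨ε ^ 2 / 432, by positivity, fun _ _ hk hkn =>
    ListModel.ofReal_le_strongConnectivityComplexity fun _ A hA =>
      ListModel.le_queries_of_decides hε A hA hk hkn⟩
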